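/- **Setting.** Let $d,d_H\in\mathbb{N}$, let $\mathcal X\subseteq\mathbb{R}^d$, and let $x\mapsto\rho(x)$ be a map from $\mathcal X$ to the $d_H\times d_H$ density matrices (positive semidefinite complex matrices of trace one). Let $r,p\in[1,\infty]$, $b\ge 0$, $\varepsilon\ge 0$. Write $\|\cdot\|_p$ for the $\ell_p$-norm of vectors and for the Schatten $p$-norm of matrices. Put $$\mathcal A_r=\{A\in\mathbb{C}^{d_H\times d_H}: A=A^\dagger,\ \|A\|_r\le b\},\qquad \mathcal F_r=\{x\mapsto \mathrm{Tr}(A\rho(x)) : A\in\mathcal A_r\},$$ and define the adversarial classes of functions on $\mathcal X\times\{\pm1\}$ under $(p,\varepsilon)$-classical and $(p,\varepsilon)$-quantum attacks by $$\mathcal F^C_{r,p,\varepsilon}=\Big\{(x,y)\mapsto \inf_{x'\in\mathcal X:\ \|x-x'\|_p\le\varepsilon} y f(x') : f\in\mathcal F_r\Big\},$$ $$\mathcal F^Q_{r,p,\varepsilon}=\Big\{(x,y)\mapsto \inf_{\rho'\text{ density matrix}:\ \|\rho(x)-\rho'\|_p\le\varepsilon} y\,\mathrm{Tr}(A\rho')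 : A\in\mathcal A_r\Big\}.$$ For a class $\mathcal H$ of real functions and a sample $z_1,\dots,z_m$, $m\ge1$, the empirical Rademacher complexity is $$\mathcal R(\mathcal H)=\mathbb{E}_\sigma\Big[\sup_{h\in\mathcal H}\frac1m\sum_{i=1}^m\sigma_i h(z_i)\Big],$$ with $\sigma$ uniform on $\{\pm1\}^m$. Finally let (with $r/(r-1)=\infty$ for $r=1$ and $r/(r-1)=1$ for $r=\infty$) $$\mathcal S^C_{r,p,\varepsilon}=d_H\sup_{x,x'\in\mathcal X:\ \|x-x'\|_p\le\varepsilon}\|\rho(x)-\rho(x')\|_{\frac r{r-1}},\qquad \mathcal S^Q_{r,p,\varepsilon}=d_H\sup_{x\in\mathcal X,\ \rho'\text{ density matrix}:\ \|\rho(x)-\rho'\|_p\le\varepsilon}\|\rho(x)-\rho'\|_{\frac r{r-1}}.$$ **Theorem.** There is a function $J$ of $r\in[1,\infty]$ alone, with $J(r)=O\big(\sqrt{1+1/r}\big)$ (that is, $|J(r)|\le C\sqrt{1+1/r}$ for all $r\in[1,\infty]$ with an absolute constant $C$), such that in every setting as above, for every $m\ge1$ and every data set $(x_1,y_1),\dots,(x_m,y_m)\in\mathcal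 X\times\{\pm1\}$, $$\mathcal R(\mathcal F^C_{r,p,\varepsilon})\le\mathcal R(\mathcal F_r)+\frac{b\,\mathcal S^C_{r,p,\varepsilon}\,J(r)}{\sqrt m}\qquad\text{and}\qquad \mathcal R(\mathcal F^Q_{r,p,\varepsilon})\le\mathcal R(\mathcal F_r)+\frac{b\,\mathcal S^Q_{r,p,\varepsilon}\,J(r)}{\sqrt m},$$ where the adversarial complexities are evaluated on $(x_1,y_1),\dots,(x_m,y_m)$ and $\mathcal R(\mathcal F_r)$ on $x_1,\dots,x_m$. Moreover $$\mathcal S^Q_{r,p,\varepsilon}\le\varepsilon\max\big\{d_H,\ d_H^{\,2-1/r-1/p}\big\}.$$ -/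

import Mathlib

open scoped ENNReal ComplexOrder

noncomputable section

/-- The Schatten `r`-norm of a complex matrix, `1 ≤ r ≤ ∞`: the `ℓ^r`-norm of the family of
singular values, i.e. of the square roots of the eigenvalues of `Aᴴ * A` with multiplicity. For
finite `r` this is `(∑ᵢ sᵢ ^ r) ^ (1 / r) = (Tr |A| ^ r) ^ (1 / r)`, and for `r = ∞` it is
`maxᵢ sᵢ`. -/
def schattenNorm {n : ℕ} (r : ℝ≥0∞) (A : Matrix (Fin n) (Fin n) ℂ) : ℝ :=
  ‖(WithLp.toLp r
      (fun i => √((Matrix.isHermitian_conjTranspose_mul_self A).eigenvalues i)) :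
        PiLp r (fun _ : Fin n => ℝ))‖

/-- Density matrices of size `n`: positive semidefinite (in particular Hermitian), trace one. -/
def DensityMatrix (n : ℕ) : Type :=
  {ρ : Matrix (Fin n) (Fin n) ℂ // ρ.PosSemidef ∧ ρ.trace = 1}

/-- The underlying matrix of a density matrix. -/
def DensityMatrix.mat {n : ℕ} (ρ : DensityMatrix n) : Matrix (Fin n) (Fin n) ℂ := ρ.1

/-- The observables: Hermitian matrices with Schatten `r`-norm at most `b`. -/
def observables (n : ℕ) (r : ℝ≥0∞) (b : ℝ) : Set (Matrix (Fin n) (Fin n) ℂ) :=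
  {A | A.IsHermitian ∧ schattenNorm r A ≤ b}

/-- The expectation `Tr (A ρ)` of an observable `A` in the state `ρ`. The trace is a real number
when `A` is Hermitian. -/
def expectation {n : ℕ} (A : Matrix (Fin n) (Fin n) ℂ) (ρ : DensityMatrix n) : ℝ :=
  (A * ρ.mat).trace.re

/-- The `ℓ^p`-distance of two vectors of `ℝ^d`, `1 ≤ p ≤ ∞`. -/
def lpDist {d : ℕ} (p : ℝ≥0∞) (x x' : Fin d → ℝ) : ℝ :=
  ‖(WithLp.toLp p (x - x') : PiLp p (fun _ : Fin d => ℝ))‖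

/-- The empirical Rademacher complexity `𝔼_σ sup_{h ∈ H} (1/m) ∑ᵢ σᵢ h(zᵢ)` of a class `H` of
real functions on a sample `z₁, …, z_m`; the signs `σ` are uniform on `{+1, -1}^m`. -/
def rademacherComplexity {Z : Type*} {m : ℕ} (H : Set (Z → ℝ)) (z : Fin m → Z) : ℝ :=
  (∑ σ : Fin m → ℤˣ,
    sSup {t : ℝ | ∃ h ∈ H, t = (1 / (m : ℝ)) * ∑ i, ((σ i : ℤ) : ℝ) * h (z i)}) / 2 ^ m

section Classes

variable {d n : ℕ} {X : Set (Fin d → ℝ)}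

/-- The class of functions `x ↦ Tr (A ρ(x))`, with `A` an observable. -/
def functionClass (ρ : X → DensityMatrix n) (r : ℝ≥0∞) (b : ℝ) : Set (X → ℝ) :=
  {f | ∃ A ∈ observables n r b, f = fun x => expectation A (ρ x)}

/-- The adversarial function class of the `(p, ε)`-classical attack: the functions
`(x, y) ↦ min {y f(x') : x' ∈ X, ‖x - x'‖_p ≤ ε}`, with `f` in the function class. The minimum is
read as an infimum; the labels `y ∈ {+1, -1}` are the elements of `ℤˣ`. -/
def classicalAdvClass (ρ : X → DensityMatrix n) (r : ℝ≥0∞) (b : ℝ) (p : ℝ≥0∞) (ε : ℝ) :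
    Set (X × ℤˣ → ℝ) :=
  {h | ∃ f ∈ functionClass ρ r b, h = fun z =>
    sInf {t : ℝ | ∃ x' : X, lpDist p (z.1 : Fin d → ℝ) (x' : Fin d → ℝ) ≤ ε ∧
      t = ((z.2 : ℤ) : ℝ) * f x'}}

/-- The adversarial function class of the `(p, ε)`-quantum attack: the functions
`(x, y) ↦ min {y Tr (A ρ') : ρ' a density matrix, ‖ρ(x) - ρ'‖_p ≤ ε}`, with `A` an observable. -/
def quantumAdvClass (ρ : X → DensityMatrix n) (r : ℝ≥0∞) (b : ℝ) (p : ℝ≥0∞) (ε : ℝ) :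
    Set (X × ℤˣ → ℝ) :=
  {h | ∃ A ∈ observables n r b, h = fun z =>
    sInf {t : ℝ | ∃ ρ' : DensityMatrix n, schattenNorm p ((ρ z.1).mat - ρ'.mat) ≤ ε ∧
      t = ((z.2 : ℤ) : ℝ) * expectation A ρ'}}

/-- `d_H * sup {‖ρ(x) - ρ(x')‖_{r/(r-1)} : x, x' ∈ X, ‖x - x'‖_p ≤ ε}`. -/
def classicalS (ρ : X → DensityMatrix n) (r p : ℝ≥0∞) (ε : ℝ) : ℝ :=
  (n : ℝ) * sSup {t : ℝ | ∃ x x' : X, lpDist p (x : Fin d → ℝ) (x' : Fin d → ℝ) ≤ ε ∧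
    t = schattenNorm (ENNReal.conjExponent r) ((ρ x).mat - (ρ x').mat)}

/-- `d_H * sup {‖ρ(x) - ρ'‖_{r/(r-1)} : x ∈ X, ρ' a density matrix, ‖ρ(x) - ρ'‖_p ≤ ε}`. -/
def quantumS (ρ : X → DensityMatrix n) (r p : ℝ≥0∞) (ε : ℝ) : ℝ :=
  (n : ℝ) * sSup {t : ℝ | ∃ (x : X) (ρ' : DensityMatrix n),
    schattenNorm p ((ρ x).mat - ρ'.mat) ≤ ε ∧
    t = schattenNorm (ENNReal.conjExponent r) ((ρ x).mat - ρ'.mat)}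

end Classes

end

/-! An attacked value splits as `y Tr(A ρ(x))` plus a gap, the infimum over the attack set minus the
value at `ρ(x)` itself. The supremum over `A` is subadditive, and multiplying the signs by the
labels permutes the sign vectors, so the first part contributes exactly the complexity of the
unattacked class.

The gap is controlled by Dudley-type chaining over the observables. It vanishes at `A = 0` and is
1-Lipschitz for the seminorm that takes the largest `|Tr(A(ρ(xᵢ) - ρ'))|` over the sample and the
allowed attacks (`worstExpectation_gap_le`). By Hölder's inequality for Schatten norms, the
observables lie in a ball of radius `b * D` for this seminorm, where `D` bounds the conjugate-norm
size of the attacks. In dimension `N`, covering numbers grow like `5 ^ (k * N)`, and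
`rademacher_chaining` gives `9 * b * D * √N / √m`. Hermitian matrices have `N ≤ 2 * n ^ 2`, hence
the factor `d_H` in both quantities `S` and the constant choice `J = 9√2`.

The bound on the quantum `S` compares two Schatten norms through the `ℓ^p` norms of singular values.
-/

/-! ### Exponential moments of sign sums and maxima over finite classes. -/

/-- The sum factors into `∏ 2 cosh (a i)`, and `cosh x ≤ exp (x² / 2)`. -/
theorem sum_exp_signs_le {m : ℕ} {c : ℝ} (a : Fin m → ℝ) (ha : ∀ i, |a i| ≤ c) :
    ∑ σ : Fin m → ℤˣ, Real.exp (∑ i, ((σ i : ℤ) : ℝ) * a i) ≤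
      2 ^ m * Real.exp (m * c ^ 2 / 2) := by
  have h1 : ∑ σ : Fin m → ℤˣ, Real.exp (∑ i, ((σ i : ℤ) : ℝ) * a i) =
      ∏ i, (2 * Real.cosh (a i)) := by
    simp_rw [Real.exp_sum]
    rw [← Fintype.prod_sum (fun (i : Fin m) (u : ℤˣ) => Real.exp (((u : ℤ) : ℝ) * a i))]
    refine Finset.prod_congr rfl fun i _ => ?_
    rw [show (Finset.univ : Finset ℤˣ) = {1, -1} from rfl, Finset.sum_pair (by decide),
      Real.cosh_eq]
    simp only [Units.val_one, Int.cast_one, one_mul, Units.val_neg, Int.cast_neg, neg_mul]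
    ring
  rw [h1, Finset.prod_mul_distrib]
  have h2 : ∏ i, Real.cosh (a i) ≤ ∏ _i : Fin m, Real.exp (c ^ 2 / 2) := by
    refine Finset.prod_le_prod (fun i _ => (Real.cosh_pos _).le) fun i _ => ?_
    refine (Real.cosh_le_exp_half_sq _).trans (Real.exp_le_exp.2 ?_)
    have := sq_le_sq.2 ((ha i).trans (le_abs_self c))
    linarith
  have h3 : ∏ _i : Fin m, Real.exp (c ^ 2 / 2) = Real.exp (m * c ^ 2 / 2) := by
    rw [Finset.prod_const, Finset.card_univ, Fintype.card_fin, ← Real.exp_nat_mul]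
    ring_nf
  rw [h3] at h2
  simpa using h2

theorem card_signs (m : ℕ) : (Fintype.card (Fin m → ℤˣ) : ℝ) = 2 ^ m := by
  simp

/-- **Massart's finite class lemma**, for a function `M` dominated by the maximum over the class. -/
theorem massart_finite_class {ι : Type*} {m : ℕ} (hm : 0 < m) {c l s : ℝ} (hc : 0 < c) (hs : 0 < s)
    (S : Finset ι) (hS : (S.card : ℝ) ≤ Real.exp l) (v : ι → Fin m → ℝ)
    (hv : ∀ t ∈ S, ∀ i, |v t i| ≤ c) (M : (Fin m → ℤˣ) → ℝ)
    (hM : ∀ σ, ∃ t ∈ S, M σ ≤ ∑ i, ((σ i : ℤ) : ℝ) * v t i) :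
    (∑ σ, M σ) / 2 ^ m ≤ c * √(m : ℝ) * (l / s + s / 2) := by
  have hm' : (0 : ℝ) < m := by exact_mod_cast hm
  have hsm : 0 < √(m : ℝ) := Real.sqrt_pos.2 hm'
  have hsm2 : √(m : ℝ) ^ 2 = m := Real.sq_sqrt hm'.le
  set r : ℝ := s / (c * √(m : ℝ)) with hr
  have hr0 : 0 < r := by positivity
  have hrc : m * (r * c) ^ 2 / 2 = s ^ 2 / 2 := by
    rw [hr, mul_pow, div_pow, mul_pow, hsm2]; field_simp
  -- `K` is the logarithm of the bound on the averaged sum of exponentials. The tangent inequality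
  -- `u + 1 ≤ exp u` at `u = r * M σ - K` replaces Jensen. The parameter `s` stays free; chaining
  -- takes `s = √N`.
  set K : ℝ := l + s ^ 2 / 2 with hK
  have h1 : ∀ σ, r * M σ ≤
      (∑ t ∈ S, Real.exp (∑ i, ((σ i : ℤ) : ℝ) * (r * v t i))) * Real.exp (-K) + (K - 1) := by
    intro σ
    obtain ⟨t, ht, hle⟩ := hM σ
    have e1 := Real.add_one_le_exp (r * M σ - K)
    have e2 : Real.exp (r * M σ) ≤ ∑ t ∈ S, Real.exp (∑ i, ((σ i : ℤ) : ℝ) * (r * v t i)) := by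
      refine le_trans (Real.exp_le_exp.2 ?_) (Finset.single_le_sum
        (f := fun t => Real.exp (∑ i, ((σ i : ℤ) : ℝ) * (r * v t i)))
        (fun _ _ => (Real.exp_pos _).le) ht)
      calc r * M σ ≤ r * ∑ i, ((σ i : ℤ) : ℝ) * v t i := by gcongr
        _ = _ := by rw [Finset.mul_sum]; exact Finset.sum_congr rfl fun i _ => by ring
    have e3 := mul_le_mul_of_nonneg_right e2 (Real.exp_pos (-K)).le
    rw [← Real.exp_add, ← sub_eq_add_neg] at e3
    linarith
  have h2 : r * ∑ σ, M σ ≤ 2 ^ m * K := by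
    calc r * ∑ σ, M σ ≤ ∑ σ : Fin m → ℤˣ,
          ((∑ t ∈ S, Real.exp (∑ i, ((σ i : ℤ) : ℝ) * (r * v t i))) * Real.exp (-K) + (K - 1)) := by
          rw [Finset.mul_sum]; exact Finset.sum_le_sum fun σ _ => h1 σ
      _ = (∑ t ∈ S, ∑ σ : Fin m → ℤˣ, Real.exp (∑ i, ((σ i : ℤ) : ℝ) * (r * v t i)))
            * Real.exp (-K) + 2 ^ m * (K - 1) := by
          rw [Finset.sum_add_distrib, ← Finset.sum_mul, Finset.sum_comm, Finset.sum_const,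
            Finset.card_univ, nsmul_eq_mul, card_signs]
      _ ≤ (∑ t ∈ S, 2 ^ m * Real.exp (m * (r * c) ^ 2 / 2)) * Real.exp (-K)
            + 2 ^ m * (K - 1) := by
          gcongr with t ht
          refine sum_exp_signs_le _ fun i => ?_
          rw [abs_mul, abs_of_pos hr0]
          gcongr
          exact hv t ht i
      _ ≤ (Real.exp l * (2 ^ m * Real.exp (s ^ 2 / 2))) * Real.exp (-K) + 2 ^ m * (K - 1) := by
          rw [hrc, Finset.sum_const, nsmul_eq_mul]
          gcongr
      _ = 2 ^ m * K := by
          have : Real.exp l * Real.exp (s ^ 2 / 2) * Real.exp (-K) = 1 := by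
            rw [← Real.exp_add, ← Real.exp_add, hK]; simp
          linear_combination 2 ^ m * this
  rw [div_le_iff₀ (by positivity)]
  have h3 : ∑ σ, M σ ≤ 2 ^ m * K / r := by
    rw [le_div_iff₀ hr0]; linarith
  refine h3.trans (le_of_eq ?_)
  rw [hr, hK]; field_simp

/-! ### Covering numbers and chaining in finite dimension. -/

section Chaining

variable {V E : Type*} [AddCommGroup V] [Module ℝ V] [FiniteDimensional ℝ V]
  [NormedAddCommGroup E] [NormedSpace ℝ E]

/-- Rescaling by `2 / R` reduces to 1-separated points in a ball of radius 2, at most `5 ^ dim`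
many. As `φ` may have a kernel, the count takes place in its range, where separation keeps the
points of `S` distinct. -/
theorem card_le_of_separated_map (φ : V →ₗ[ℝ] E) {R : ℝ} (hR : 0 < R) (t₀ : V) (S : Finset V)
    (hS : ∀ s ∈ S, ‖φ s - φ t₀‖ ≤ R)
    (hsep : ∀ s ∈ S, ∀ t ∈ S, s ≠ t → R / 2 ≤ ‖φ s - φ t‖) :
    S.card ≤ 5 ^ Module.finrank ℝ V := by
  classical
  let W := LinearMap.range φ
  let f : V → W := fun v => (2 / R) • φ.rangeRestrict (v - t₀)
  have hf : ∀ s t, ‖f s - f t‖ = 2 / R * ‖φ s - φ t‖ := by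
    intro s t
    have : f s - f t = (2 / R) • φ.rangeRestrict (s - t) := by
      simp only [f, ← smul_sub, ← map_sub, sub_sub_sub_cancel_right]
    rw [this, norm_smul, Real.norm_of_nonneg (by positivity)]
    simp
  have hinj : Set.InjOn f S := by
    intro s hs t ht hst
    by_contra hne
    have h1 := hsep s hs t ht hne
    have h2 := hf s t
    rw [hst, sub_self, norm_zero] at h2
    have : 0 < 2 / R * ‖φ s - φ t‖ := by
      have : 0 < ‖φ s - φ t‖ := lt_of_lt_of_le (by positivity) h1
      positivity
    linarith
  have hcard : (S.image f).card ≤ 5 ^ Module.finrank ℝ W := by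
    apply Besicovitch.card_le_of_separated
    · intro c hc
      obtain ⟨s, hs, rfl⟩ := Finset.mem_image.1 hc
      have h := hf s t₀
      have h0 : f t₀ = 0 := by simp [f]
      rw [h0, sub_zero] at h
      rw [h]
      calc 2 / R * ‖φ s - φ t₀‖ ≤ 2 / R * R := by gcongr; exact hS s hs
        _ = 2 := by field_simp
    · intro c hc d hd hcd
      obtain ⟨s, hs, rfl⟩ := Finset.mem_image.1 hc
      obtain ⟨t, ht, rfl⟩ := Finset.mem_image.1 hd
      rw [hf]
      have h1 := hsep s hs t ht (fun h => hcd (by rw [h]))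
      calc (1 : ℝ) = 2 / R * (R / 2) := by field_simp
        _ ≤ _ := by gcongr
  rw [Finset.card_image_of_injOn hinj] at hcard
  exact hcard.trans (Nat.pow_le_pow_right (by norm_num) (LinearMap.finrank_range_le φ))

/-- The part of `T` in a ball of radius `R` has an inner `R / 2`-net with at most `5 ^ dim` points. -/
theorem exists_half_net (φ : V →ₗ[ℝ] E) {R : ℝ} (hR : 0 < R) (T : Set V) (t₀ : V) :
    ∃ S : Finset V, ↑S ⊆ T ∧ (∀ s ∈ S, ‖φ s - φ t₀‖ ≤ R) ∧ S.card ≤ 5 ^ Module.finrank ℝ V ∧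
      ∀ t ∈ T, ‖φ t - φ t₀‖ ≤ R → ∃ s ∈ S, ‖φ t - φ s‖ ≤ R / 2 := by
  classical
  let P : Finset V → Prop := fun S => ↑S ⊆ T ∧ (∀ s ∈ S, ‖φ s - φ t₀‖ ≤ R) ∧
    ∀ s ∈ S, ∀ t ∈ S, s ≠ t → R / 2 ≤ ‖φ s - φ t‖
  let Q : ℕ → Prop := fun k => ∃ S, P S ∧ S.card = k
  have hQ0 : Q 0 := ⟨∅, ⟨by simp, by simp, by simp⟩, rfl⟩
  have hbound : ∀ S, P S → S.card ≤ 5 ^ Module.finrank ℝ V := fun S hS =>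
    card_le_of_separated_map φ hR t₀ S hS.2.1 hS.2.2
  -- A separated set of maximal cardinality is a net: an uncovered point could be added to it.
  obtain ⟨S, hS, hcard⟩ : Q (Nat.findGreatest Q (5 ^ Module.finrank ℝ V)) :=
    Nat.findGreatest_spec (Nat.zero_le _) hQ0
  refine ⟨S, hS.1, hS.2.1, hbound S hS, fun t ht htR => ?_⟩
  by_contra! hcon
  have htS : t ∉ S := fun h => by
    have := hcon t h
    rw [sub_self, norm_zero] at this
    linarith
  have hP : P (insert t S) := by
    refine ⟨?_, ?_, ?_⟩
    · rw [Finset.coe_insert]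
      exact Set.insert_subset ht hS.1
    · intro s hs
      rcases Finset.mem_insert.1 hs with rfl | hs
      · exact htR
      · exact hS.2.1 s hs
    · intro s hs u hu hne
      rcases Finset.mem_insert.1 hs with h1 | h1 <;>
        rcases Finset.mem_insert.1 hu with h2 | h2
      · exact absurd (h1.trans h2.symm) hne
      · rw [h1]; exact (hcon u h2).le
      · rw [h2, norm_sub_rev]; exact (hcon s h1).le
      · exact hS.2.2 s h1 u h2 hne
  have h1 := Nat.le_findGreatest (hbound _ hP) (P := Q) ⟨_, hP, rfl⟩
  rw [Finset.card_insert_of_notMem htS] at h1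
  omega

theorem five_pow_le_exp (N k : ℕ) : ((5 ^ (k * N) : ℕ) : ℝ) ≤ Real.exp (2 * k * N) := by
  have h5 : (5 : ℝ) ≤ Real.exp 2 := by
    have h := Real.exp_one_gt_d9
    have : Real.exp 2 = Real.exp 1 * Real.exp 1 := by rw [← Real.exp_add]; norm_num
    rw [this]; nlinarith
  have : Real.exp (2 * k * N) = Real.exp 2 ^ (k * N) := by
    rw [← Real.exp_nat_mul]; push_cast; ring_nf
  rw [this]
  push_cast
  gcongr

/-- Each point of level `k + 1` has a parent of level `k` at distance at most `R / 2 ^ k`, and the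
finite class lemma bounds the increments. With `l = 2(k+1)N` and `s = √N`, a level costs `R√m√N
(4k+5) / 2^(k+1)`; these costs sum to the stated `9 - (4k+9) / 2^k`, which is `0` at `k = 0`. The
nets stay inside `T`, where the Lipschitz bound holds. -/
theorem exists_chaining_net (φ : V →ₗ[ℝ] E) (hN : 0 < Module.finrank ℝ V) {R : ℝ} (hR : 0 < R)
    {m : ℕ} (hm : 0 < m) (T : Set V) (t₀ : V) (ht₀ : t₀ ∈ T) (hT : ∀ t ∈ T, ‖φ t - φ t₀‖ ≤ R)
    (g : Fin m → V → ℝ) (hg : ∀ i, ∀ s ∈ T, ∀ t ∈ T, |g i s - g i t| ≤ ‖φ s - φ t‖)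
    (hg₀ : ∀ i, g i t₀ = 0) (k : ℕ) :
    ∃ S : Finset V, ↑S ⊆ T ∧ S.card ≤ 5 ^ (k * Module.finrank ℝ V) ∧
      (∀ t ∈ T, ∃ s ∈ S, ‖φ t - φ s‖ ≤ R / 2 ^ k) ∧
      ∀ M : (Fin m → ℤˣ) → ℝ, (∀ σ, ∃ t ∈ S, M σ ≤ ∑ i, ((σ i : ℤ) : ℝ) * g i t) →
        (∑ σ, M σ) / 2 ^ m ≤
          R * √(m : ℝ) * √(Module.finrank ℝ V : ℝ) * (9 - (4 * k + 9) / 2 ^ k) := by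
  classical
  set N := Module.finrank ℝ V with hNdef
  have hN' : (0 : ℝ) < N := by exact_mod_cast hN
  induction k with
  | zero =>
    refine ⟨{t₀}, by simpa using ht₀, by simp, fun t ht => ⟨t₀, by simp, by simpa using hT t ht⟩,
      fun M hM => ?_⟩
    have : ∑ σ, M σ ≤ 0 := Finset.sum_nonpos fun σ _ => by
      obtain ⟨t, ht, h⟩ := hM σ
      rw [Finset.mem_singleton.1 ht] at h
      simpa [hg₀] using h
    simpa using div_nonpos_of_nonpos_of_nonneg this (by positivity)
  | succ k ih =>
    obtain ⟨S, hST, hScard, hSnet, hSM⟩ := ih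
    have hRk : 0 < R / 2 ^ k := by positivity
    choose C hCT hCR hCcard hCnet using fun s => exists_half_net φ hRk T s
    refine ⟨S.biUnion C, ?_, ?_, ?_, ?_⟩
    · intro t ht
      obtain ⟨s, -, hs⟩ := Finset.mem_biUnion.1 (Finset.mem_coe.1 ht)
      exact hCT s hs
    · calc (S.biUnion C).card ≤ S.card * 5 ^ N :=
            Finset.card_biUnion_le_card_mul _ _ _ fun s _ => hCcard s
        _ ≤ 5 ^ (k * N) * 5 ^ N := Nat.mul_le_mul_right _ hScard
        _ = 5 ^ ((k + 1) * N) := by ring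
    · intro t ht
      obtain ⟨s, hs, hts⟩ := hSnet t ht
      obtain ⟨u, hu, htu⟩ := hCnet s t ht hts
      refine ⟨u, Finset.mem_biUnion.2 ⟨s, hs, hu⟩, htu.trans (le_of_eq ?_)⟩
      rw [pow_succ]; field_simp
    · intro M hM
      -- The parent map is made total on `V`; its value off the net is the irrelevant default `0`.
      have hpar : ∀ t, ∃ s, t ∈ S.biUnion C → s ∈ S ∧ ‖φ t - φ s‖ ≤ R / 2 ^ k ∧ t ∈ T := by
        intro t
        by_cases ht : t ∈ S.biUnion C
        · obtain ⟨s, hs, hts⟩ := Finset.mem_biUnion.1 ht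
          exact ⟨s, fun _ => ⟨hs, hCR s t hts, hCT s hts⟩⟩
        · exact ⟨0, fun h => absurd h ht⟩
      choose par hparS using hpar
      choose τ hτ hMτ using hM
      have hA := hSM (fun σ => ∑ i, ((σ i : ℤ) : ℝ) * g i (par (τ σ)))
        fun σ => ⟨_, (hparS _ (hτ σ)).1, le_rfl⟩
      have hcard : ((S.biUnion C).card : ℝ) ≤ Real.exp (2 * ((k + 1 : ℕ) : ℝ) * N) := by
        refine le_trans ?_ (five_pow_le_exp N (k + 1))
        norm_cast
        calc (S.biUnion C).card ≤ S.card * 5 ^ N :=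
            Finset.card_biUnion_le_card_mul _ _ _ fun s _ => hCcard s
          _ ≤ 5 ^ (k * N) * 5 ^ N := Nat.mul_le_mul_right _ hScard
          _ = 5 ^ ((k + 1) * N) := by ring
      have hB := massart_finite_class hm hRk (Real.sqrt_pos.2 hN') (S.biUnion C) hcard
        (fun t i => g i t - g i (par t))
        (fun t ht i => by
          obtain ⟨h1, h2, h3⟩ := hparS t ht
          exact (hg i t h3 _ (hST h1)).trans h2)
        (fun σ => ∑ i, ((σ i : ℤ) : ℝ) * (g i (τ σ) - g i (par (τ σ))))
        fun σ => ⟨_, hτ σ, le_rfl⟩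
      have hsum : (∑ σ, M σ) / 2 ^ m ≤
          (∑ σ : Fin m → ℤˣ, ∑ i, ((σ i : ℤ) : ℝ) * g i (par (τ σ))) / 2 ^ m +
          (∑ σ : Fin m → ℤˣ, ∑ i, ((σ i : ℤ) : ℝ) * (g i (τ σ) - g i (par (τ σ)))) / 2 ^ m := by
        rw [← add_div, ← Finset.sum_add_distrib]
        gcongr with σ
        rw [← Finset.sum_add_distrib]
        refine (hMτ σ).trans (le_of_eq (Finset.sum_congr rfl fun i _ => by ring))
      refine hsum.trans ((add_le_add hA hB).trans (le_of_eq ?_))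
      have hsq : √(N : ℝ) ^ 2 = N := Real.sq_sqrt hN'.le
      have : 2 * ((k + 1 : ℕ) : ℝ) * N / √(N : ℝ) = 2 * (k + 1) * √(N : ℝ) := by
        have := Real.sqrt_pos.2 hN'
        rw [div_eq_iff this.ne', mul_assoc _ (√(N : ℝ)), ← sq, hsq]; push_cast; ring
      rw [this, pow_succ]
      push_cast
      field_simp
      ring

/-- The Rademacher average of a family indexed by a bounded set of a finite-dimensional space and
Lipschitz in the index, by chaining. -/
theorem rademacher_chaining (φ : V →ₗ[ℝ] E) (hN : 0 < Module.finrank ℝ V) {R : ℝ} (hR : 0 < R)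
    {m : ℕ} (hm : 0 < m) (T : Set V) (t₀ : V) (ht₀ : t₀ ∈ T) (hT : ∀ t ∈ T, ‖φ t - φ t₀‖ ≤ R)
    (g : Fin m → V → ℝ) (hg : ∀ i, ∀ s ∈ T, ∀ t ∈ T, |g i s - g i t| ≤ ‖φ s - φ t‖)
    (hg₀ : ∀ i, g i t₀ = 0) :
    (∑ σ : Fin m → ℤˣ,
        sSup {u : ℝ | ∃ t ∈ T, u = (1 / (m : ℝ)) * ∑ i, ((σ i : ℤ) : ℝ) * g i t}) / 2 ^ m ≤
      9 * R * √(Module.finrank ℝ V : ℝ) / √(m : ℝ) := by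
  classical
  have hm' : (0 : ℝ) < m := by exact_mod_cast hm
  set B := 9 * R * √(Module.finrank ℝ V : ℝ) / √(m : ℝ) with hB
  -- Moving to the nearest point of the level-`k` net changes the mean by at most `R / 2 ^ k`, which
  -- vanishes as `k → ∞`.
  have key : ∀ k : ℕ, (∑ σ : Fin m → ℤˣ,
        sSup {u : ℝ | ∃ t ∈ T, u = (1 / (m : ℝ)) * ∑ i, ((σ i : ℤ) : ℝ) * g i t}) / 2 ^ m ≤
      B + R * (1 / 2 : ℝ) ^ k := by
    intro k
    obtain ⟨S, hST, -, hSnet, hSM⟩ := exists_chaining_net φ hN hR hm T t₀ ht₀ hT g hg hg₀ k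
    have hSne : S.Nonempty := by
      obtain ⟨s, hs, -⟩ := hSnet t₀ ht₀
      exact ⟨s, hs⟩
    choose τ hτS hτ using fun σ : Fin m → ℤˣ =>
      S.exists_max_image (fun t => ∑ i, ((σ i : ℤ) : ℝ) * g i t) hSne
    have h1 := hSM (fun σ => ∑ i, ((σ i : ℤ) : ℝ) * g i (τ σ)) fun σ => ⟨_, hτS σ, le_rfl⟩
    have h2 : ∀ σ : Fin m → ℤˣ,
        sSup {u : ℝ | ∃ t ∈ T, u = (1 / (m : ℝ)) * ∑ i, ((σ i : ℤ) : ℝ) * g i t} ≤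
          (1 / (m : ℝ)) * (∑ i, ((σ i : ℤ) : ℝ) * g i (τ σ)) + R * (1 / 2 : ℝ) ^ k := by
      intro σ
      refine csSup_le ⟨_, t₀, ht₀, rfl⟩ ?_
      rintro u ⟨t, ht, rfl⟩
      obtain ⟨s, hs, hts⟩ := hSnet t ht
      have h3 : ∑ i, ((σ i : ℤ) : ℝ) * g i t ≤
          (∑ i, ((σ i : ℤ) : ℝ) * g i s) + m * (R / 2 ^ k) := by
        have : ∑ i, ((σ i : ℤ) : ℝ) * g i t ≤ ∑ i, (((σ i : ℤ) : ℝ) * g i s + R / 2 ^ k) := by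
          refine Finset.sum_le_sum fun i _ => ?_
          have h4 := (hg i t ht s (hST hs)).trans hts
          have h5 := abs_le.1 h4
          rcases Int.units_eq_one_or (σ i) with h | h <;> rw [h] <;> push_cast <;> linarith
        rw [Finset.sum_add_distrib] at this
        simpa using this
      have h6 := h3.trans (add_le_add_left (hτ σ s hs) _)
      calc (1 / (m : ℝ)) * ∑ i, ((σ i : ℤ) : ℝ) * g i t
          ≤ (1 / (m : ℝ)) * ((∑ i, ((σ i : ℤ) : ℝ) * g i (τ σ)) + m * (R / 2 ^ k)) := by gcongr
        _ = _ := by rw [one_div_pow]; field_simp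
    have h7 : (∑ σ : Fin m → ℤˣ,
        sSup {u : ℝ | ∃ t ∈ T, u = (1 / (m : ℝ)) * ∑ i, ((σ i : ℤ) : ℝ) * g i t}) / 2 ^ m ≤
        (1 / (m : ℝ)) * ((∑ σ : Fin m → ℤˣ, ∑ i, ((σ i : ℤ) : ℝ) * g i (τ σ)) / 2 ^ m)
          + R * (1 / 2 : ℝ) ^ k := by
      rw [div_le_iff₀ (by positivity)]
      refine (Finset.sum_le_sum fun σ _ => h2 σ).trans (le_of_eq ?_)
      rw [Finset.sum_add_distrib, Finset.sum_const, Finset.card_univ, nsmul_eq_mul, card_signs,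
        ← Finset.mul_sum]
      field_simp
    refine h7.trans (add_le_add_left ?_ _)
    have h8 : (9 : ℝ) - (4 * k + 9) / 2 ^ k ≤ 9 := by
      have : (0 : ℝ) ≤ (4 * k + 9) / 2 ^ k := by positivity
      linarith
    calc (1 / (m : ℝ)) * ((∑ σ : Fin m → ℤˣ, ∑ i, ((σ i : ℤ) : ℝ) * g i (τ σ)) / 2 ^ m)
        ≤ (1 / (m : ℝ)) * (R * √(m : ℝ) * √(Module.finrank ℝ V : ℝ) * 9) := by
          gcongr
          exact h1.trans (by gcongr)
      _ = B := by
          rw [hB]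
          have hsm : 0 < √(m : ℝ) := Real.sqrt_pos.2 hm'
          have : √(m : ℝ) ^ 2 = m := Real.sq_sqrt hm'.le
          rw [← this]
          field_simp
          rw [Real.sqrt_sq hsm.le]
  have hlim : Filter.Tendsto (fun k : ℕ => B + R * (1 / 2 : ℝ) ^ k) Filter.atTop
      (nhds (B + R * 0)) :=
    ((tendsto_pow_atTop_nhds_zero_of_lt_one (by norm_num) (by norm_num)).const_mul R).const_add B
  rw [mul_zero, add_zero] at hlim
  exact ge_of_tendsto' hlim key

end Chaining

/-- Equal multiplicities make corresponding fibres equinumerous, and fibrewise bijections glue. This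
matches squared eigenvalues of `A` with eigenvalues of `Aᴴ * A`. -/
theorem exists_perm_of_map_univ_eq {ι α : Type*} [Fintype ι] (f g : ι → α)
    (h : Multiset.map f Finset.univ.val = Multiset.map g Finset.univ.val) :
    ∃ e : ι ≃ ι, ∀ i, f i = g (e i) := by
  classical
  have hc : ∀ a, Nonempty ({i // f i = a} ≃ {i // g i = a}) := fun a => by
    rw [← Fintype.card_eq, Fintype.card_subtype, Fintype.card_subtype]
    have := congrArg (Multiset.count a) h
    rw [Multiset.count_map, Multiset.count_map] at this
    simpa [Finset.card, Finset.filter_val, eq_comm] using this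
  exact ⟨Equiv.ofFiberEquiv fun a => (hc a).some, fun i => (Equiv.ofFiberEquiv_map _ i).symm⟩

/-! ### Hölder's inequality and comparison of finite `ℓ^p` norms. -/

section PiLpNorm

variable {ι : Type*} [Fintype ι]

theorem PiLp.norm_toLp_comp_equiv {p : ℝ≥0∞} (hp : 1 ≤ p) (e : ι ≃ ι) (a : ι → ℝ) :
    ‖(WithLp.toLp p (fun i => a (e i)) : PiLp p (fun _ : ι => ℝ))‖ =
      ‖(WithLp.toLp p a : PiLp p (fun _ : ι => ℝ))‖ := by
  have : Fact (1 ≤ p) := ⟨hp⟩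
  exact (LinearIsometryEquiv.piLpCongrLeft p ℝ ℝ e.symm).norm_map (WithLp.toLp p a)

theorem PiLp.norm_toLp_abs {p : ℝ≥0∞} (hp : 1 ≤ p) (a : ι → ℝ) :
    ‖(WithLp.toLp p (fun i => |a i|) : PiLp p (fun _ : ι => ℝ))‖ =
      ‖(WithLp.toLp p a : PiLp p (fun _ : ι => ℝ))‖ := by
  rcases eq_or_ne p ∞ with rfl | hp'
  · simp [PiLp.norm_eq_ciSup]
  · have h0 : 0 < p.toReal := ENNReal.toReal_pos (by positivity) hp'
    simp [PiLp.norm_eq_sum h0]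

theorem PiLp.sum_mul_le_norm_top_mul_norm_one (a b : ι → ℝ) :
    ∑ i, a i * b i ≤ ‖(WithLp.toLp ∞ a : PiLp ∞ (fun _ : ι => ℝ))‖ *
      ‖(WithLp.toLp 1 b : PiLp 1 (fun _ : ι => ℝ))‖ := by
  rw [PiLp.norm_eq_of_L1, Finset.mul_sum]
  refine Finset.sum_le_sum fun i _ => (le_abs_self _).trans ?_
  rw [abs_mul]
  exact mul_le_mul_of_nonneg_right
    (PiLp.norm_apply_le (WithLp.toLp ∞ a : PiLp ∞ (fun _ : ι => ℝ)) i) (abs_nonneg _)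

/-- **Hölder's inequality** for finite families, with all conjugate exponents in `[1, ∞]`. -/
theorem PiLp.sum_mul_le_norm_mul_norm {p q : ℝ≥0∞} [hpq : p.HolderConjugate q] (a b : ι → ℝ) :
    ∑ i, a i * b i ≤ ‖(WithLp.toLp p a : PiLp p (fun _ : ι => ℝ))‖ *
      ‖(WithLp.toLp q b : PiLp q (fun _ : ι => ℝ))‖ := by
  rcases eq_or_ne p ∞ with rfl | hp
  · obtain rfl : q = 1 := by
      have := ENNReal.HolderTriple.inv_add_inv_eq_inv ∞ q 1
      simpa using this
    exact PiLp.sum_mul_le_norm_top_mul_norm_one a b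
  rcases eq_or_ne q ∞ with rfl | hq
  · obtain rfl : p = 1 := by
      have := ENNReal.HolderTriple.inv_add_inv_eq_inv p ∞ 1
      simpa using this
    have := PiLp.sum_mul_le_norm_top_mul_norm_one b a
    rw [mul_comm]
    simpa [mul_comm] using this
  · have h := ENNReal.HolderConjugate.toReal_of_ne_top (p := p) (q := q) hp hq
    rw [PiLp.norm_eq_sum h.pos, PiLp.norm_eq_sum h.symm.pos]
    exact Real.inner_le_Lp_mul_Lq Finset.univ a b h

theorem PiLp.norm_le_norm_of_exponent_le {p q : ℝ≥0∞} (hp : 1 ≤ p) (hpq : p ≤ q) (a : ι → ℝ) :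
    ‖(WithLp.toLp q a : PiLp q (fun _ : ι => ℝ))‖ ≤
      ‖(WithLp.toLp p a : PiLp p (fun _ : ι => ℝ))‖ := by
  have hq : 1 ≤ q := hp.trans hpq
  have : Fact (1 ≤ p) := ⟨hp⟩
  have : Fact (1 ≤ q) := ⟨hq⟩
  set A := ‖(WithLp.toLp p a : PiLp p (fun _ : ι => ℝ))‖ with hA
  have hA0 : 0 ≤ A := norm_nonneg _
  have hle : ∀ i, |a i| ≤ A :=
    fun i => PiLp.norm_apply_le (WithLp.toLp p a : PiLp p (fun _ : ι => ℝ)) i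
  rcases eq_or_ne q ∞ with rfl | hq'
  · rw [PiLp.norm_eq_ciSup]
    exact Real.iSup_le hle hA0
  have hp' : p ≠ ∞ := ne_top_of_le_ne_top hq' hpq
  have hp0 : 0 < p.toReal := ENNReal.toReal_pos (by positivity) hp'
  have hq0 : 0 < q.toReal := ENNReal.toReal_pos (by positivity) hq'
  have hpq' : p.toReal ≤ q.toReal := ENNReal.toReal_mono hq' hpq
  have hAp : ∑ i, |a i| ^ p.toReal = A ^ p.toReal := by
    rw [hA, PiLp.norm_eq_sum hp0, ← Real.rpow_mul (by positivity)]
    simp [hp0.ne']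
  rw [PiLp.norm_eq_sum hq0]
  have h1 : ∑ i, |a i| ^ q.toReal ≤ A ^ q.toReal := by
    -- Each entry is at most the `p`-norm `A`, so the surplus power `q - p` can be pulled out.
    calc ∑ i, |a i| ^ q.toReal ≤ ∑ i, |a i| ^ p.toReal * A ^ (q.toReal - p.toReal) := by
          refine Finset.sum_le_sum fun i _ => ?_
          have : q.toReal = p.toReal + (q.toReal - p.toReal) := by ring
          rw [this, Real.rpow_add_of_nonneg (abs_nonneg _) hp0.le (by linarith),
            add_sub_cancel_left]
          exact mul_le_mul_of_nonneg_left
            (Real.rpow_le_rpow (abs_nonneg _) (hle i) (by linarith)) (by positivity)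
      _ = A ^ q.toReal := by
          rw [← Finset.sum_mul, hAp, ← Real.rpow_add_of_nonneg hA0 hp0.le (by linarith)]
          congr 1; ring
  calc (∑ i, ‖(WithLp.toLp q a : PiLp q (fun _ : ι => ℝ)) i‖ ^ q.toReal) ^ (1 / q.toReal)
      ≤ (A ^ q.toReal) ^ (1 / q.toReal) :=
        Real.rpow_le_rpow (by positivity) h1 (by positivity)
    _ = A := by rw [← Real.rpow_mul hA0]; simp [hq0.ne']

theorem PiLp.norm_le_card_rpow_mul_norm {p q : ℝ≥0∞} (hq : 1 ≤ q) (hqp : q ≤ p) (a : ι → ℝ) :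
    ‖(WithLp.toLp q a : PiLp q (fun _ : ι => ℝ))‖ ≤
      (Fintype.card ι : ℝ) ^ ((1 / q).toReal - (1 / p).toReal) *
      ‖(WithLp.toLp p a : PiLp p (fun _ : ι => ℝ))‖ := by
  have hp : 1 ≤ p := hq.trans hqp
  have : Fact (1 ≤ p) := ⟨hp⟩
  rcases eq_or_ne q ∞ with rfl | hq'
  · obtain rfl : p = ∞ := top_le_iff.1 hqp
    simp
  have hq0 : 0 < q.toReal := ENNReal.toReal_pos (by positivity) hq'
  rw [PiLp.norm_eq_sum hq0]
  have hq1 : (1 / q).toReal = 1 / q.toReal := by simp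
  rcases eq_or_ne p ∞ with rfl | hp'
  · set A := ‖(WithLp.toLp ∞ a : PiLp ∞ (fun _ : ι => ℝ))‖ with hA
    have hA0 : 0 ≤ A := norm_nonneg _
    have hle : ∀ i, |a i| ≤ A :=
      fun i => PiLp.norm_apply_le (WithLp.toLp ∞ a : PiLp ∞ (fun _ : ι => ℝ)) i
    have h1 : ∑ i, |a i| ^ q.toReal ≤ (Fintype.card ι : ℝ) * A ^ q.toReal := by
      calc ∑ i, |a i| ^ q.toReal ≤ ∑ _i : ι, A ^ q.toReal :=
            Finset.sum_le_sum fun i _ => Real.rpow_le_rpow (abs_nonneg _) (hle i) hq0.le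
        _ = _ := by simp
    calc _ ≤ ((Fintype.card ι : ℝ) * A ^ q.toReal) ^ (1 / q.toReal) :=
          Real.rpow_le_rpow (by positivity) h1 (by positivity)
      _ = _ := by
          rw [Real.mul_rpow (by positivity) (by positivity), ← Real.rpow_mul hA0, hq1]
          simp [hq0.ne']
  have hp0 : 0 < p.toReal := ENNReal.toReal_pos (by positivity) hp'
  have hqp' : q.toReal ≤ p.toReal := ENNReal.toReal_mono hp' hqp
  have hp1 : (1 / p).toReal = 1 / p.toReal := by simp
  rw [PiLp.norm_eq_sum hp0, hq1, hp1]
  have hs : 1 ≤ p.toReal / q.toReal := (one_le_div hq0).2 hqp'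
  -- Power-mean inequality with exponent `p / q ≥ 1`, applied to the `|a i| ^ q`.
  have h1 := Real.rpow_sum_le_const_mul_sum_rpow Finset.univ (fun i => |a i| ^ q.toReal) hs
  have h2 : ∀ i, |(|a i| ^ q.toReal)| ^ (p.toReal / q.toReal) = |a i| ^ p.toReal := fun i => by
    rw [abs_of_nonneg (by positivity), ← Real.rpow_mul (abs_nonneg _)]
    congr 1; field_simp
  simp only [h2, Finset.card_univ] at h1
  simp only [abs_of_nonneg (Real.rpow_nonneg (abs_nonneg _) q.toReal)] at h1
  have h3 := Real.rpow_le_rpow (by positivity) h1 (show 0 ≤ 1 / p.toReal by positivity)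
  rw [← Real.rpow_mul (by positivity), Real.mul_rpow (by positivity) (by positivity),
    ← Real.rpow_mul (by positivity)] at h3
  have e1 : p.toReal / q.toReal * (1 / p.toReal) = 1 / q.toReal := by field_simp
  have e2 : (p.toReal / q.toReal - 1) * (1 / p.toReal) = 1 / q.toReal - 1 / p.toReal := by
    field_simp
  rw [e1, e2] at h3
  exact h3

theorem PiLp.norm_le_max_mul_norm [Nonempty ι] {p q : ℝ≥0∞} (hp : 1 ≤ p) (hq : 1 ≤ q)
    (a : ι → ℝ) :
    ‖(WithLp.toLp q a : PiLp q (fun _ : ι => ℝ))‖ ≤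
      max 1 ((Fintype.card ι : ℝ) ^ ((1 / q).toReal - (1 / p).toReal)) *
      ‖(WithLp.toLp p a : PiLp p (fun _ : ι => ℝ))‖ := by
  have : Fact (1 ≤ p) := ⟨hp⟩
  rcases le_total p q with h | h
  · refine (PiLp.norm_le_norm_of_exponent_le hp h a).trans ?_
    exact le_mul_of_one_le_left (norm_nonneg _) (le_max_left _ _)
  · refine (PiLp.norm_le_card_rpow_mul_norm hq h a).trans ?_
    exact mul_le_mul_of_nonneg_right (le_max_right _ _) (norm_nonneg _)

end PiLpNorm

/-! ### Schatten norms of Hermitian matrices and trace duality. -/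

section Schatten

variable {n : ℕ} {A B : Matrix (Fin n) (Fin n) ℂ}

open Polynomial in
theorem Matrix.IsHermitian.charpoly_conjTranspose_mul_self (hA : A.IsHermitian) :
    (A.conjTranspose * A).charpoly = ∏ i, (X - C (((hA.eigenvalues i) ^ 2 : ℝ) : ℂ)) := by
  have h : A.conjTranspose * A = Unitary.conjStarAlgAut ℂ _ hA.eigenvectorUnitary
      (Matrix.diagonal (fun i => (((hA.eigenvalues i) ^ 2 : ℝ) : ℂ))) := by
    rw [hA.eq]
    conv_lhs => rw [hA.spectral_theorem, ← map_mul, Matrix.diagonal_mul_diagonal]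
    congr 2
    funext i
    simp [sq]
  rw [h, Unitary.conjStarAlgAut_apply, Matrix.charpoly_mul_comm, ← mul_assoc]
  simp [Matrix.charpoly_diagonal]

/-- Comparing roots of the characteristic polynomial of `Aᴴ * A` shows that the singular values are
the `|λᵢ|` up to order, and the `ℓ^r` norm ignores order and signs. -/
theorem schattenNorm_eq_norm_eigenvalues {r : ℝ≥0∞} (hr : 1 ≤ r) (hA : A.IsHermitian) :
    schattenNorm r A =
      ‖(WithLp.toLp r hA.eigenvalues : PiLp r (fun _ : Fin n => ℝ))‖ := by
  have h1 := (Matrix.isHermitian_conjTranspose_mul_self A).roots_charpoly_eq_eigenvalues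
  rw [hA.charpoly_conjTranspose_mul_self, Polynomial.roots_prod _ _
    (Finset.prod_ne_zero_iff.2 fun i _ => Polynomial.X_sub_C_ne_zero _)] at h1
  simp only [Polynomial.roots_X_sub_C, Multiset.bind_singleton] at h1
  obtain ⟨e, he⟩ := exists_perm_of_map_univ_eq _ _ h1
  have he' : ∀ i, (hA.eigenvalues i) ^ 2 =
      (Matrix.isHermitian_conjTranspose_mul_self A).eigenvalues (e i) := fun i => by
    have := congrArg Complex.re (he i)
    simpa only [Function.comp_apply, Complex.coe_algebraMap, Complex.ofReal_re] using this
  rw [schattenNorm, ← PiLp.norm_toLp_comp_equiv hr e, ← PiLp.norm_toLp_abs hr hA.eigenvalues]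
  simp_rw [← he', Real.sqrt_sq_eq_abs]

theorem schattenNorm_nonneg {r : ℝ≥0∞} (hr : 1 ≤ r) (A : Matrix (Fin n) (Fin n) ℂ) :
    0 ≤ schattenNorm r A := by
  have : Fact (1 ≤ r) := ⟨hr⟩
  exact norm_nonneg _

theorem schattenNorm_zero {r : ℝ≥0∞} (hr : 1 ≤ r) :
    schattenNorm r (0 : Matrix (Fin n) (Fin n) ℂ) = 0 := by
  have : Fact (1 ≤ r) := ⟨hr⟩
  have h := (Matrix.isHermitian_zero (n := Fin n) (α := ℂ))
  rw [schattenNorm_eq_norm_eigenvalues hr h, h.eigenvalues_eq_zero_iff.2 rfl]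
  simp

/-- Rows and columns of a unitary matrix are unit vectors. -/
theorem sq_norm_mem_doublyStochastic {W : Matrix (Fin n) (Fin n) ℂ} (h1 : W * star W = 1)
    (h2 : star W * W = 1) :
    Matrix.of (fun i j => ‖W i j‖ ^ 2) ∈ doublyStochastic ℝ (Fin n) := by
  rw [mem_doublyStochastic_iff_sum]
  refine ⟨fun i j => by rw [Matrix.of_apply]; positivity, fun i => ?_, fun j => ?_⟩
  · have := congrFun (congrFun h1 i) i
    rw [Matrix.mul_apply, Matrix.one_apply_eq] at this
    simp only [Matrix.star_apply, RCLike.star_def, Complex.mul_conj,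
      Complex.normSq_eq_norm_sq] at this
    simp only [Matrix.of_apply]
    exact_mod_cast this
  · have := congrFun (congrFun h2 j) j
    rw [Matrix.mul_apply, Matrix.one_apply_eq] at this
    simp only [Matrix.star_apply, RCLike.star_def, mul_comm ((starRingEnd ℂ) _), Complex.mul_conj,
      Complex.normSq_eq_norm_sq] at this
    simp only [Matrix.of_apply]
    exact_mod_cast this

theorem trace_diagonal_mul_conj_diagonal_re (a b : Fin n → ℝ) (W : Matrix (Fin n) (Fin n) ℂ) :
    (Matrix.diagonal (fun i => (a i : ℂ)) * W * Matrix.diagonal (fun i => (b i : ℂ)) *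
      star W).trace.re = ∑ i, ∑ j, a i * b j * ‖W i j‖ ^ 2 := by
  rw [Matrix.trace, Complex.re_sum]
  refine Finset.sum_congr rfl fun i _ => ?_
  rw [Matrix.diag_apply, Matrix.mul_apply, Complex.re_sum]
  refine Finset.sum_congr rfl fun j _ => ?_
  rw [Matrix.mul_diagonal, Matrix.diagonal_mul, Matrix.star_apply, RCLike.star_def]
  have h : (a i : ℂ) * W i j * (b j : ℂ) * (starRingEnd ℂ) (W i j) =
      ((a i * b j * ‖W i j‖ ^ 2 : ℝ) : ℂ) := by
    have h4 := Complex.mul_conj (W i j)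
    rw [Complex.normSq_eq_norm_sq] at h4
    push_cast at h4 ⊢
    rw [← h4]
    ring
  rw [h, Complex.ofReal_re]

/-- The trace of a product of Hermitian matrices pairs their eigenvalues through a doubly
stochastic matrix. -/
theorem exists_doublyStochastic_trace_mul (hA : A.IsHermitian) (hB : B.IsHermitian) :
    ∃ w ∈ doublyStochastic ℝ (Fin n),
      (A * B).trace.re = ∑ i, ∑ j, hA.eigenvalues i * hB.eigenvalues j * w i j := by
  obtain ⟨U, a, hUa, ha⟩ : ∃ (U : Matrix.unitaryGroup (Fin n) ℂ) (a : Fin n → ℝ),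
      a = hA.eigenvalues ∧ A = U.1 * Matrix.diagonal (fun i => (a i : ℂ)) * star U.1 :=
    ⟨hA.eigenvectorUnitary, _, rfl, by
      have h := hA.spectral_theorem
      rw [Unitary.conjStarAlgAut_apply] at h
      exact h⟩
  obtain ⟨V, b, hVb, hb⟩ : ∃ (V : Matrix.unitaryGroup (Fin n) ℂ) (b : Fin n → ℝ),
      b = hB.eigenvalues ∧ B = V.1 * Matrix.diagonal (fun i => (b i : ℂ)) * star V.1 :=
    ⟨hB.eigenvectorUnitary, _, rfl, by
      have h := hB.spectral_theorem
      rw [Unitary.conjStarAlgAut_apply] at h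
      exact h⟩
  have hU1 : U.1 * star U.1 = 1 := Unitary.mul_star_self_of_mem U.2
  have hU2 : star U.1 * U.1 = 1 := Unitary.star_mul_self_of_mem U.2
  have hV1 : V.1 * star V.1 = 1 := Unitary.mul_star_self_of_mem V.2
  have hV2 : star V.1 * V.1 = 1 := Unitary.star_mul_self_of_mem V.2
  refine ⟨Matrix.of (fun i j => ‖(star U.1 * V.1) i j‖ ^ 2),
    sq_norm_mem_doublyStochastic ?_ ?_, ?_⟩
  · rw [star_mul, star_star, mul_assoc, ← mul_assoc V.1, hV1, one_mul, hU2]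
  · rw [star_mul, star_star, mul_assoc, ← mul_assoc U.1, hU1, one_mul, hV2]
  · rw [← hUa, ← hVb]
    simp only [Matrix.of_apply]
    rw [← trace_diagonal_mul_conj_diagonal_re, ha, hb, star_mul, star_star]
    generalize Matrix.diagonal (fun i => (a i : ℂ)) = D
    generalize Matrix.diagonal (fun i => (b i : ℂ)) = D'
    rw [mul_assoc U.1, mul_assoc U.1, Matrix.trace_mul_comm]
    simp only [mul_assoc]

/-- **Hölder's inequality** for the Schatten norms of Hermitian matrices. -/
theorem trace_mul_re_le_schattenNorm {r q : ℝ≥0∞} [r.HolderConjugate q] (hr : 1 ≤ r) (hq : 1 ≤ q)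
    (hA : A.IsHermitian) (hB : B.IsHermitian) :
    (A * B).trace.re ≤ schattenNorm r A * schattenNorm q B := by
  obtain ⟨w, hw, hwt⟩ := exists_doublyStochastic_trace_mul hA hB
  rw [hwt, schattenNorm_eq_norm_eigenvalues hr hA, schattenNorm_eq_norm_eigenvalues hq hB]
  -- Birkhoff's theorem: the pairing is a convex combination of pairings along permutations, each
  -- bounded by the scalar Hölder inequality.
  obtain ⟨c, hc0, hc1, hcw⟩ := exists_eq_sum_perm_of_mem_doublyStochastic hw
  set M := ‖(WithLp.toLp r hA.eigenvalues : PiLp r (fun _ : Fin n => ℝ))‖ *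
    ‖(WithLp.toLp q hB.eigenvalues : PiLp q (fun _ : Fin n => ℝ))‖
  have hperm : ∀ σ : Equiv.Perm (Fin n),
      ∑ i, ∑ j, hA.eigenvalues i * hB.eigenvalues j * σ.permMatrix ℝ i j ≤ M := by
    intro σ
    have h1 : ∀ i, ∑ j, hA.eigenvalues i * hB.eigenvalues j * σ.permMatrix ℝ i j =
        hA.eigenvalues i * hB.eigenvalues (σ i) := fun i => by
      simp [Equiv.Perm.permMatrix, PEquiv.toMatrix_apply, Equiv.toPEquiv_apply]
    simp_rw [h1]
    refine (PiLp.sum_mul_le_norm_mul_norm (p := r) (q := q) _ _).trans (le_of_eq ?_)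
    rw [PiLp.norm_toLp_comp_equiv hq σ]
  calc ∑ i, ∑ j, hA.eigenvalues i * hB.eigenvalues j * w i j
      = ∑ σ, c σ * ∑ i, ∑ j, hA.eigenvalues i * hB.eigenvalues j * σ.permMatrix ℝ i j := by
        simp_rw [← hcw, Matrix.sum_apply, Matrix.smul_apply, smul_eq_mul, Finset.mul_sum]
        rw [Finset.sum_comm]
        refine Eq.trans (Finset.sum_congr rfl fun j _ => Finset.sum_comm) ?_
        rw [Finset.sum_comm]
        refine Finset.sum_congr rfl fun σ _ => ?_
        rw [Finset.sum_comm]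
        refine Finset.sum_congr rfl fun i _ => Finset.sum_congr rfl fun j _ => by ring
    _ ≤ ∑ σ, c σ * M := Finset.sum_le_sum fun σ _ =>
        mul_le_mul_of_nonneg_left (hperm σ) (hc0 σ)
    _ = M := by rw [← Finset.sum_mul, hc1, one_mul]

theorem abs_trace_mul_re_le_schattenNorm {r q : ℝ≥0∞} [r.HolderConjugate q] (hr : 1 ≤ r)
    (hq : 1 ≤ q) (hA : A.IsHermitian) (hB : B.IsHermitian) :
    |(A * B).trace.re| ≤ schattenNorm r A * schattenNorm q B := by
  refine abs_le'.2 ⟨trace_mul_re_le_schattenNorm hr hq hA hB, ?_⟩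
  have h := trace_mul_re_le_schattenNorm hr hq hA.neg hB
  have h2 : schattenNorm r (-A) = schattenNorm r A := by
    simp [schattenNorm]
  rw [h2] at h
  simpa using h

theorem schattenNorm_le_max_mul {p q : ℝ≥0∞} (hn : 0 < n) (hp : 1 ≤ p) (hq : 1 ≤ q)
    (A : Matrix (Fin n) (Fin n) ℂ) :
    schattenNorm q A ≤
      max 1 ((n : ℝ) ^ ((1 / q).toReal - (1 / p).toReal)) * schattenNorm p A := by
  have : Nonempty (Fin n) := ⟨⟨0, hn⟩⟩
  have h := PiLp.norm_le_max_mul_norm hp hq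
    (fun i => √((Matrix.isHermitian_conjTranspose_mul_self A).eigenvalues i))
  rw [Fintype.card_fin] at h
  exact h

end Schatten

/-! ### Density matrices and boundedness of their differences. -/

namespace DensityMatrix

variable {n : ℕ}

theorem isHermitian (ρ : DensityMatrix n) : ρ.mat.IsHermitian := ρ.2.1.1

theorem isHermitian_sub (ρ ρ' : DensityMatrix n) : (ρ.mat - ρ'.mat).IsHermitian :=
  ρ.isHermitian.sub ρ'.isHermitian

theorem sum_eigenvalues (ρ : DensityMatrix n) : ∑ i, ρ.isHermitian.eigenvalues i = 1 := by
  have h1 := ρ.isHermitian.trace_eq_sum_eigenvalues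
  have h2 : ρ.mat.trace = 1 := ρ.2.2
  rw [h2] at h1
  have := congrArg Complex.re h1
  simpa using this.symm

theorem eigenvalues_nonneg (ρ : DensityMatrix n) (i : Fin n) :
    0 ≤ ρ.isHermitian.eigenvalues i := ρ.2.1.eigenvalues_nonneg i

theorem dim_pos (ρ : DensityMatrix n) : 0 < n := by
  rcases Nat.eq_zero_or_pos n with rfl | h
  · have := ρ.sum_eigenvalues
    simp at this
  · exact h

theorem trace_mul_nonneg (ρ ρ' : DensityMatrix n) : 0 ≤ (ρ.mat * ρ'.mat).trace.re := by
  obtain ⟨w, hw, h⟩ := exists_doublyStochastic_trace_mul ρ.isHermitian ρ'.isHermitian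
  rw [h]
  exact Finset.sum_nonneg fun i _ => Finset.sum_nonneg fun j _ =>
    mul_nonneg (mul_nonneg (ρ.eigenvalues_nonneg i) (ρ'.eigenvalues_nonneg j))
      (nonneg_of_mem_doublyStochastic hw)

theorem trace_mul_le_one (ρ ρ' : DensityMatrix n) : (ρ.mat * ρ'.mat).trace.re ≤ 1 := by
  obtain ⟨w, hw, h⟩ := exists_doublyStochastic_trace_mul ρ.isHermitian ρ'.isHermitian
  rw [h]
  calc _ ≤ ∑ i, ∑ j, ρ.isHermitian.eigenvalues i * ρ'.isHermitian.eigenvalues j :=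
        Finset.sum_le_sum fun i _ => Finset.sum_le_sum fun j _ =>
          mul_le_of_le_one_right (mul_nonneg (ρ.eigenvalues_nonneg i) (ρ'.eigenvalues_nonneg j))
            (le_one_of_mem_doublyStochastic hw)
    _ = 1 := by rw [← Finset.sum_mul_sum, sum_eigenvalues, sum_eigenvalues, one_mul]

/-- The squared singular values sum to `Tr (ρ - ρ')² ≤ 2`. The crude constant suffices, since only
finiteness of the suprema in the quantities `S` depends on it. -/
theorem schattenNorm_top_sub_le (ρ ρ' : DensityMatrix n) :
    schattenNorm ∞ (ρ.mat - ρ'.mat) ≤ 2 := by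
  set B := ρ.mat - ρ'.mat with hB
  set h := Matrix.isHermitian_conjTranspose_mul_self B
  have h0 : ∀ i, 0 ≤ h.eigenvalues i :=
    fun i => (Matrix.posSemidef_conjTranspose_mul_self B).eigenvalues_nonneg i
  have hsum : ∑ i, h.eigenvalues i ≤ 2 := by
    have h1 := congrArg Complex.re h.trace_eq_sum_eigenvalues
    have h2 : (B * B).trace.re = (ρ.mat * ρ.mat).trace.re + (ρ'.mat * ρ'.mat).trace.re
        - (ρ.mat * ρ'.mat).trace.re - (ρ'.mat * ρ.mat).trace.re := by
      simp only [hB, sub_mul, mul_sub, Matrix.trace_sub, Complex.sub_re]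
      ring
    have h3 := ρ.trace_mul_le_one ρ
    have h4 := ρ'.trace_mul_le_one ρ'
    have h5 := ρ.trace_mul_nonneg ρ'
    have h6 := ρ'.trace_mul_nonneg ρ
    have h8 : (B.conjTranspose * B).trace.re = (B * B).trace.re := by
      rw [(ρ.isHermitian_sub ρ').eq]
    rw [h8, h2] at h1
    simp only [Complex.re_sum, Complex.coe_algebraMap, Complex.ofReal_re] at h1
    linarith
  rw [schattenNorm, PiLp.norm_eq_ciSup]
  refine Real.iSup_le (fun i => ?_) (by norm_num)
  have h7 : h.eigenvalues i ≤ 2 :=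
    (Finset.single_le_sum (fun j _ => h0 j) (Finset.mem_univ i)).trans hsum
  rw [Real.norm_of_nonneg (Real.sqrt_nonneg _), Real.sqrt_le_iff]
  exact ⟨by norm_num, h7.trans (by norm_num)⟩

theorem exists_schattenNorm_sub_le (n : ℕ) {q : ℝ≥0∞} (hq : 1 ≤ q) :
    ∃ c, ∀ ρ ρ' : DensityMatrix n, schattenNorm q (ρ.mat - ρ'.mat) ≤ c :=
  ⟨max 1 ((n : ℝ) ^ ((1 / q).toReal - (1 / ∞ : ℝ≥0∞).toReal)) * 2, fun ρ ρ' =>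
    (schattenNorm_le_max_mul ρ.dim_pos le_top hq _).trans
      (mul_le_mul_of_nonneg_left (ρ.schattenNorm_top_sub_le ρ') (by positivity))⟩

end DensityMatrix

/-! ### Attack gaps of observables and their Rademacher averages. -/

section Expectation

variable {n : ℕ}

theorem expectation_sub_expectation (A : Matrix (Fin n) (Fin n) ℂ) (ρ ρ' : DensityMatrix n) :
    expectation A ρ - expectation A ρ' = (A * (ρ.mat - ρ'.mat)).trace.re := by
  simp [expectation, mul_sub]

theorem expectation_zero (ρ : DensityMatrix n) : expectation 0 ρ = 0 := by
  simp [expectation]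

theorem zero_mem_observables {r : ℝ≥0∞} (hr : 1 ≤ r) {b : ℝ} (hb : 0 ≤ b) :
    (0 : Matrix (Fin n) (Fin n) ℂ) ∈ observables n r b :=
  ⟨Matrix.isHermitian_zero, by rw [schattenNorm_zero hr]; exact hb⟩

theorem abs_expectation_le {r q : ℝ≥0∞} [r.HolderConjugate q] (hr : 1 ≤ r) (hq : 1 ≤ q) {b : ℝ}
    {A : Matrix (Fin n) (Fin n) ℂ} (hA : A ∈ observables n r b) (ρ : DensityMatrix n) :
    |expectation A ρ| ≤ b * schattenNorm q ρ.mat :=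
  (abs_trace_mul_re_le_schattenNorm hr hq hA.1 ρ.isHermitian).trans
    (mul_le_mul_of_nonneg_right hA.2 (schattenNorm_nonneg hq _))

theorem abs_units_mul (u : ℤˣ) (a : ℝ) : |((u : ℤ) : ℝ) * a| = |a| := by
  rcases Int.units_eq_one_or u with rfl | rfl <;> simp

theorem mean_signs_mul_le {m : ℕ} (σ : Fin m → ℤˣ) {a c : Fin m → ℝ} (h : ∀ i, |a i| ≤ c i) :
    (1 / (m : ℝ)) * ∑ i, ((σ i : ℤ) : ℝ) * a i ≤ (1 / (m : ℝ)) * ∑ i, c i := by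
  gcongr with i
  exact (le_abs_self _).trans ((abs_units_mul _ _).le.trans (h i))

/-- The real vector space of Hermitian matrices. -/
abbrev HermitianSpace (n : ℕ) : Type := selfAdjoint.submodule ℝ (Matrix (Fin n) (Fin n) ℂ)

theorem HermitianSpace.isHermitian (A : HermitianSpace n) : A.1.IsHermitian :=
  selfAdjoint.mem_iff.1 A.2

/-- The real dimension of all complex matrices is a sufficient bound; it costs a factor `√2` in `J`.
-/
theorem finrank_hermitianSpace_le : Module.finrank ℝ (HermitianSpace n) ≤ 2 * n ^ 2 := by
  refine (Submodule.finrank_le _).trans (le_of_eq ?_)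
  rw [finrank_real_of_complex, Module.finrank_matrix]
  simp [sq]

theorem finrank_hermitianSpace_pos (hn : 0 < n) : 0 < Module.finrank ℝ (HermitianSpace n) := by
  have : Nonempty (Fin n) := ⟨⟨0, hn⟩⟩
  have : Nontrivial (HermitianSpace n) :=
    ⟨⟨0, ⟨1, Matrix.isHermitian_one⟩, fun h => zero_ne_one (congrArg Subtype.val h)⟩⟩
  exact Module.finrank_pos

/-- The expectation gaps of a Hermitian matrix, between the states `ρ i` and the states of `P i`,
as a bounded family. -/
noncomputable def expectationGap {m : ℕ} {r q : ℝ≥0∞} [r.HolderConjugate q] (hr : 1 ≤ r) (hq : 1 ≤ q)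
    (ρ : Fin m → DensityMatrix n) (P : Fin m → Set (DensityMatrix n)) {D : ℝ}
    (hD : ∀ i, ∀ ρ' ∈ P i, schattenNorm q ((ρ i).mat - ρ'.mat) ≤ D) :
    HermitianSpace n →ₗ[ℝ] lp (fun _ : (Σ i, P i) => ℝ) ∞ where
  toFun A := ⟨fun k => (A.1 * ((ρ k.1).mat - k.2.1.mat)).trace.re, memℓp_infty <| by
    refine ⟨schattenNorm r A.1 * D, ?_⟩
    rintro _ ⟨k, rfl⟩
    exact (abs_trace_mul_re_le_schattenNorm hr hq A.isHermitian
      (DensityMatrix.isHermitian_sub _ _)).trans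
      (mul_le_mul_of_nonneg_left (hD _ _ k.2.2) (schattenNorm_nonneg hr _))⟩
  map_add' A B := by
    ext k
    rw [lp.coeFn_add, Pi.add_apply]
    simp [add_mul]
  map_smul' c A := by
    ext k
    simp

theorem expectationGap_apply {m : ℕ} {r q : ℝ≥0∞} [r.HolderConjugate q] (hr : 1 ≤ r) (hq : 1 ≤ q)
    (ρ : Fin m → DensityMatrix n) (P : Fin m → Set (DensityMatrix n)) {D : ℝ}
    (hD : ∀ i, ∀ ρ' ∈ P i, schattenNorm q ((ρ i).mat - ρ'.mat) ≤ D) (A : HermitianSpace n)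
    (k : Σ i, P i) : expectationGap (r := r) hr hq ρ P hD A k =
      expectation A.1 (ρ k.1) - expectation A.1 k.2.1 :=
  (expectation_sub_expectation _ _ _).symm

/-- The worst-case signed expectation over a set of states. -/
noncomputable def worstExpectation (Q : Set (DensityMatrix n)) (u : ℤˣ) (A : Matrix (Fin n) (Fin n) ℂ) : ℝ :=
  sInf {t : ℝ | ∃ ρ' ∈ Q, t = ((u : ℤ) : ℝ) * expectation A ρ'}

/-- Guards against the default value `0` of a real `sInf` over a set unbounded below. -/
theorem bddBelow_signed_expectation {r q : ℝ≥0∞} [r.HolderConjugate q] (hr : 1 ≤ r) (hq : 1 ≤ q)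
    {ρ : DensityMatrix n} {Q : Set (DensityMatrix n)} {D : ℝ}
    (hD : ∀ ρ' ∈ Q, schattenNorm q (ρ.mat - ρ'.mat) ≤ D) (u : ℤˣ)
    {A : Matrix (Fin n) (Fin n) ℂ} (hA : A.IsHermitian) :
    BddBelow {t : ℝ | ∃ ρ' ∈ Q, t = ((u : ℤ) : ℝ) * expectation A ρ'} := by
  refine ⟨-(|expectation A ρ| + schattenNorm r A * D), ?_⟩
  rintro _ ⟨ρ', hρ', rfl⟩
  have h1 : |expectation A ρ - expectation A ρ'| ≤ schattenNorm r A * D := by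
    rw [expectation_sub_expectation]
    exact (abs_trace_mul_re_le_schattenNorm hr hq hA (ρ.isHermitian_sub ρ')).trans
      (mul_le_mul_of_nonneg_left (hD _ hρ') (schattenNorm_nonneg hr _))
  have h2 := neg_abs_le (((u : ℤ) : ℝ) * expectation A ρ')
  rw [abs_units_mul] at h2
  have h3 := abs_sub_abs_le_abs_sub (expectation A ρ') (expectation A ρ)
  rw [abs_sub_comm] at h3
  linarith

/-- The gap is an infimum of signed entries of `expectationGap`, and an infimum moves by at most the
sup-norm change of its entries. -/
theorem worstExpectation_gap_le {m : ℕ} {r q : ℝ≥0∞} [r.HolderConjugate q] (hr : 1 ≤ r)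
    (hq : 1 ≤ q) (ρ : Fin m → DensityMatrix n) (P : Fin m → Set (DensityMatrix n))
    (hP : ∀ i, ρ i ∈ P i) {D : ℝ}
    (hD : ∀ i, ∀ ρ' ∈ P i, schattenNorm q ((ρ i).mat - ρ'.mat) ≤ D)
    (y : Fin m → ℤˣ) (i : Fin m) (A B : HermitianSpace n) :
    (worstExpectation (P i) (y i) A.1 - ((y i : ℤ) : ℝ) * expectation A.1 (ρ i)) -
      (worstExpectation (P i) (y i) B.1 - ((y i : ℤ) : ℝ) * expectation B.1 (ρ i)) ≤
      ‖expectationGap (r := r) hr hq ρ P hD A - expectationGap (r := r) hr hq ρ P hD B‖ := by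
  set φ := expectationGap (r := r) hr hq ρ P hD with hφ
  have h : worstExpectation (P i) (y i) A.1 - ((y i : ℤ) : ℝ) * expectation A.1 (ρ i) +
      ((y i : ℤ) : ℝ) * expectation B.1 (ρ i) - ‖φ A - φ B‖ ≤
      worstExpectation (P i) (y i) B.1 := by
    refine le_csInf ⟨_, ρ i, hP i, rfl⟩ ?_
    rintro _ ⟨ρ', hρ', rfl⟩
    have h1 : worstExpectation (P i) (y i) A.1 ≤ ((y i : ℤ) : ℝ) * expectation A.1 ρ' :=
      csInf_le (bddBelow_signed_expectation (r := r) hr hq (hD i) (y i) A.isHermitian)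
        ⟨ρ', hρ', rfl⟩
    have h2 := lp.norm_apply_le_norm ENNReal.top_ne_zero (φ A - φ B)
      (⟨i, ⟨ρ', hρ'⟩⟩ : Σ i, P i)
    rw [lp.coeFn_sub, Pi.sub_apply, hφ, expectationGap_apply, expectationGap_apply,
      Real.norm_eq_abs, ← hφ, ← abs_units_mul (y i)] at h2
    have h3 := (abs_le.1 h2).1
    simp only [mul_sub] at h3
    linarith
  linarith

/-- Common core of both attacks: only the sets `P i` of allowed states differ. Membership `ρ i ∈ P
i` makes the infima nonempty. -/
theorem rademacher_worstExpectation_le {m : ℕ} (hm : 0 < m) {r : ℝ≥0∞} (hr : 1 ≤ r) {b : ℝ}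
    (hb : 0 ≤ b) (ρ : Fin m → DensityMatrix n) (P : Fin m → Set (DensityMatrix n))
    (hP : ∀ i, ρ i ∈ P i) {D : ℝ}
    (hD : ∀ i, ∀ ρ' ∈ P i, schattenNorm r.conjExponent ((ρ i).mat - ρ'.mat) ≤ D)
    (y : Fin m → ℤˣ) :
    (∑ σ : Fin m → ℤˣ, sSup {t : ℝ | ∃ A ∈ observables n r b,
        t = (1 / (m : ℝ)) * ∑ i, ((σ i : ℤ) : ℝ) * worstExpectation (P i) (y i) A}) / 2 ^ m ≤
      (∑ σ : Fin m → ℤˣ, sSup {t : ℝ | ∃ A ∈ observables n r b,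
        t = (1 / (m : ℝ)) * ∑ i, ((σ i : ℤ) : ℝ) * expectation A (ρ i)}) / 2 ^ m +
      9 * √2 * n * (b * D) / √(m : ℝ) := by
  set q := r.conjExponent with hq_def
  have hq : 1 ≤ q := by rw [hq_def, ENNReal.conjExponent]; exact le_self_add
  have : r.HolderConjugate q := ENNReal.HolderConjugate.conjExponent hr
  have hn : 0 < n := (ρ ⟨0, hm⟩).dim_pos
  have hm' : (0 : ℝ) < m := by exact_mod_cast hm
  have hD0 : 0 ≤ D := (schattenNorm_nonneg hq _).trans (hD ⟨0, hm⟩ _ (hP _))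
  let φ := expectationGap (r := r) hr hq ρ P hD
  let g : Fin m → HermitianSpace n → ℝ := fun i A =>
    worstExpectation (P i) (y i) A.1 - ((y i : ℤ) : ℝ) * expectation A.1 (ρ i)
  have hg : ∀ i A B, |g i A - g i B| ≤ ‖φ A - φ B‖ := fun i A B => by
    refine abs_le'.2 ⟨worstExpectation_gap_le hr hq ρ P hP hD y i A B, ?_⟩
    rw [neg_sub, norm_sub_rev]
    exact worstExpectation_gap_le hr hq ρ P hP hD y i B A
  have hg0 : ∀ i, g i 0 = 0 := fun i => by
    have : {t : ℝ | ∃ ρ' ∈ P i, t = ((y i : ℤ) : ℝ) * expectation (0 : HermitianSpace n).1 ρ'} =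
        {0} := by
      ext t
      simp only [Submodule.coe_zero, expectation_zero, mul_zero, Set.mem_ofPred_eq,
        Set.mem_singleton_iff]
      exact ⟨fun ⟨_, _, h⟩ => h, fun h => ⟨ρ i, hP i, h⟩⟩
    simp only [g, worstExpectation]
    rw [this, csInf_singleton]
    simp [expectation_zero]
  let T : Set (HermitianSpace n) := {A | A.1 ∈ observables n r b}
  have h0T : (0 : HermitianSpace n) ∈ T := zero_mem_observables hr hb
  have hTb : ∀ A ∈ T, ‖φ A - φ 0‖ ≤ b * D := fun A hA => by
    rw [map_zero, sub_zero]
    refine lp.norm_le_of_forall_le (by positivity) fun k => ?_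
    exact (abs_trace_mul_re_le_schattenNorm hr hq A.isHermitian
      (DensityMatrix.isHermitian_sub _ _)).trans
      (mul_le_mul hA.2 (hD _ _ k.2.2) (schattenNorm_nonneg hq _) hb)
  let G : (Fin m → ℤˣ) → ℝ := fun σ =>
    sSup {u : ℝ | ∃ t ∈ T, u = (1 / (m : ℝ)) * ∑ i, ((σ i : ℤ) : ℝ) * g i t}
  let F : (Fin m → ℤˣ) → ℝ := fun σ => sSup {t : ℝ | ∃ A ∈ observables n r b,
        t = (1 / (m : ℝ)) * ∑ i, ((σ i : ℤ) : ℝ) * expectation A (ρ i)}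
  have hG : (∑ σ, G σ) / 2 ^ m ≤ 9 * √2 * n * (b * D) / √(m : ℝ) := by
    have hfr : √(Module.finrank ℝ (HermitianSpace n) : ℝ) ≤ √2 * n := by
      refine (Real.sqrt_le_sqrt (y := 2 * (n : ℝ) ^ 2) ?_).trans (le_of_eq ?_)
      · exact_mod_cast finrank_hermitianSpace_le
      · rw [Real.sqrt_mul (by norm_num), Real.sqrt_sq (by positivity)]
    -- Chaining needs a positive radius while `b * D` may vanish, so `R` decreases to `b * D`.
    have hR : ∀ R, b * D < R → (∑ σ, G σ) / 2 ^ m ≤ 9 * √2 * n / √(m : ℝ) * R := by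
      intro R hR
      have hR0 : 0 < R := lt_of_le_of_lt (by positivity) hR
      refine (rademacher_chaining φ (finrank_hermitianSpace_pos hn) hR0 hm T 0 h0T
        (fun t ht => (hTb t ht).trans hR.le) g (fun i s _ t _ => hg i s t) hg0).trans ?_
      rw [div_mul_eq_mul_div]
      refine div_le_div_of_nonneg_right ?_ (Real.sqrt_nonneg _)
      calc 9 * R * √(Module.finrank ℝ (HermitianSpace n) : ℝ) ≤ 9 * R * (√2 * n) := by gcongr
        _ = _ := by ring
    have hlim : Filter.Tendsto (fun R : ℝ => 9 * √2 * n / √(m : ℝ) * R)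
        (nhdsWithin (b * D) (Set.Ioi (b * D))) (nhds (9 * √2 * n / √(m : ℝ) * (b * D))) :=
      ((continuous_const.mul continuous_id).tendsto _).mono_left nhdsWithin_le_nhds
    have := ge_of_tendsto hlim (by filter_upwards [self_mem_nhdsWithin] with R h using hR R h)
    rwa [div_mul_eq_mul_div] at this
  have hle : ∀ σ : Fin m → ℤˣ, sSup {t : ℝ | ∃ A ∈ observables n r b,
        t = (1 / (m : ℝ)) * ∑ i, ((σ i : ℤ) : ℝ) * worstExpectation (P i) (y i) A} ≤
      F (σ * y) + G σ := by
    intro σ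
    refine csSup_le ⟨_, 0, zero_mem_observables hr hb, rfl⟩ ?_
    rintro _ ⟨A, hA, rfl⟩
    let A' : HermitianSpace n := ⟨A, selfAdjoint.mem_iff.2 hA.1⟩
    have hF : (1 / (m : ℝ)) * ∑ i, (((σ * y) i : ℤ) : ℝ) * expectation A (ρ i) ≤ F (σ * y) := by
      refine le_csSup ⟨(1 / (m : ℝ)) * ∑ i, b * schattenNorm q (ρ i).mat, ?_⟩ ⟨A, hA, rfl⟩
      rintro _ ⟨B, hB, rfl⟩
      exact mean_signs_mul_le _ fun i => abs_expectation_le hr hq hB (ρ i)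
    have hG' : (1 / (m : ℝ)) * ∑ i, ((σ i : ℤ) : ℝ) * g i A' ≤ G σ := by
      refine le_csSup ⟨(1 / (m : ℝ)) * ∑ _i : Fin m, b * D, ?_⟩ ⟨A', hA, rfl⟩
      rintro _ ⟨B, hB, rfl⟩
      refine mean_signs_mul_le _ fun i => ?_
      have := (hg i B 0).trans (hTb B hB)
      rwa [hg0, sub_zero] at this
    refine le_trans (le_of_eq ?_) (add_le_add hF hG')
    rw [← mul_add, ← Finset.sum_add_distrib]
    congr 1
    refine Finset.sum_congr rfl fun i _ => ?_
    simp only [g, A', Pi.mul_apply, Units.val_mul, Int.cast_mul]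
    ring
  -- The labels are absorbed into the uniform signs.
  have hsymm : ∑ σ : Fin m → ℤˣ, F (σ * y) = ∑ σ, F σ := Equiv.sum_comp (Equiv.mulRight y) F
  refine le_trans ?_ (add_le_add_right hG _)
  rw [← add_div]
  gcongr
  refine (Finset.sum_le_sum fun σ _ => hle σ).trans (le_of_eq ?_)
  rw [Finset.sum_add_distrib, hsymm]

/-- The norm comparison costs `max 1 (n ^ (1/q - 1/p))` with `1/q = 1 - 1/r`; the prefactor `n` adds
one to the exponent. -/
theorem quantumS_le {d : ℕ} {X : Set (Fin d → ℝ)} (ρ : X → DensityMatrix n) {r p : ℝ≥0∞}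
    (hr : 1 ≤ r) (hp : 1 ≤ p) {ε : ℝ} (hε : 0 ≤ ε) :
    quantumS ρ r p ε ≤
      ε * max (n : ℝ) ((n : ℝ) ^ (2 - (1 / r).toReal - (1 / p).toReal)) := by
  set q := r.conjExponent with hq_def
  have hq : 1 ≤ q := by rw [hq_def, ENNReal.conjExponent]; exact le_self_add
  have : r.HolderConjugate q := ENNReal.HolderConjugate.conjExponent hr
  have hrq : (1 / q).toReal = 1 - (1 / r).toReal := by
    have h := congrArg ENNReal.toReal (ENNReal.HolderTriple.inv_add_inv_eq_inv r q 1)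
    rw [ENNReal.toReal_add (ENNReal.inv_ne_top.2 (by positivity))
      (ENNReal.inv_ne_top.2 (by positivity))] at h
    simp only [one_div, inv_one, ENNReal.toReal_one] at h ⊢
    linarith
  rcases isEmpty_or_nonempty X with hX | ⟨⟨x⟩⟩
  · simp only [quantumS, IsEmpty.exists_iff, Set.ofPred_false, Real.sSup_empty, mul_zero]
    positivity
  have hn : 0 < n := (ρ x).dim_pos
  have hn' : (0 : ℝ) < n := by exact_mod_cast hn
  have h1 : sSup {t : ℝ | ∃ (x : X) (ρ' : DensityMatrix n),
      schattenNorm p ((ρ x).mat - ρ'.mat) ≤ ε ∧ t = schattenNorm q ((ρ x).mat - ρ'.mat)} ≤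
      max 1 ((n : ℝ) ^ ((1 / q).toReal - (1 / p).toReal)) * ε := by
    refine Real.sSup_le ?_ (by positivity)
    rintro _ ⟨x, ρ', h, rfl⟩
    exact (schattenNorm_le_max_mul hn hp hq _).trans (by gcongr)
  calc quantumS ρ r p ε
      ≤ n * (max 1 ((n : ℝ) ^ ((1 / q).toReal - (1 / p).toReal)) * ε) := by
        rw [quantumS]; gcongr
    _ = _ := by
        rw [← mul_assoc, mul_max_of_nonneg _ _ hn'.le, mul_one, mul_comm ε]
        congr 2
        rw [hrq, show (2 : ℝ) - (1 / r).toReal - (1 / p).toReal =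
          1 + (1 - (1 / r).toReal - (1 / p).toReal) by ring, Real.rpow_add hn', Real.rpow_one]

/-! ### Complexities as suprema over observables, and the conclusion. -/

theorem rademacherComplexity_functionClass {d m : ℕ} {X : Set (Fin d → ℝ)}
    (ρ : X → DensityMatrix n) (r : ℝ≥0∞) (b : ℝ) (x : Fin m → X) :
    rademacherComplexity (functionClass ρ r b) x =
      (∑ σ : Fin m → ℤˣ, sSup {t : ℝ | ∃ A ∈ observables n r b,
        t = (1 / (m : ℝ)) * ∑ i, ((σ i : ℤ) : ℝ) * expectation A (ρ (x i))}) / 2 ^ m := by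
  simp only [rademacherComplexity, functionClass]
  congr! 6 with σ t
  constructor
  · rintro ⟨_, ⟨A, hA, rfl⟩, rfl⟩
    exact ⟨A, hA, rfl⟩
  · rintro ⟨A, hA, rfl⟩
    exact ⟨_, ⟨A, hA, rfl⟩, rfl⟩

theorem rademacherComplexity_quantumAdvClass {d m : ℕ} {X : Set (Fin d → ℝ)}
    (ρ : X → DensityMatrix n) (r : ℝ≥0∞) (b : ℝ) (p : ℝ≥0∞) (ε : ℝ) (x : Fin m → X)
    (y : Fin m → ℤˣ) :
    rademacherComplexity (quantumAdvClass ρ r b p ε) (fun i => (x i, y i)) =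
      (∑ σ : Fin m → ℤˣ, sSup {t : ℝ | ∃ A ∈ observables n r b,
        t = (1 / (m : ℝ)) * ∑ i, ((σ i : ℤ) : ℝ) * worstExpectation
          {ρ' | schattenNorm p ((ρ (x i)).mat - ρ'.mat) ≤ ε} (y i) A}) / 2 ^ m := by
  simp only [rademacherComplexity, quantumAdvClass]
  congr! 6 with σ t
  constructor
  · rintro ⟨_, ⟨A, hA, rfl⟩, rfl⟩
    exact ⟨A, hA, rfl⟩
  · rintro ⟨A, hA, rfl⟩
    exact ⟨_, ⟨A, hA, rfl⟩, rfl⟩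

theorem rademacherComplexity_classicalAdvClass {d m : ℕ} {X : Set (Fin d → ℝ)}
    (ρ : X → DensityMatrix n) (r : ℝ≥0∞) (b : ℝ) (p : ℝ≥0∞) (ε : ℝ) (x : Fin m → X)
    (y : Fin m → ℤˣ) :
    rademacherComplexity (classicalAdvClass ρ r b p ε) (fun i => (x i, y i)) =
      (∑ σ : Fin m → ℤˣ, sSup {t : ℝ | ∃ A ∈ observables n r b,
        t = (1 / (m : ℝ)) * ∑ i, ((σ i : ℤ) : ℝ) * worstExpectation
          (ρ '' {x' | lpDist p (x i : Fin d → ℝ) (x' : Fin d → ℝ) ≤ ε}) (y i) A}) / 2 ^ m := by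
  have h : ∀ (A : Matrix (Fin n) (Fin n) ℂ) (z : X) (u : ℤˣ),
      sInf {t : ℝ | ∃ x' : X, lpDist p (z : Fin d → ℝ) (x' : Fin d → ℝ) ≤ ε ∧
        t = ((u : ℤ) : ℝ) * expectation A (ρ x')} =
      worstExpectation (ρ '' {x' | lpDist p (z : Fin d → ℝ) (x' : Fin d → ℝ) ≤ ε}) u A := by
    intro A z u
    rw [worstExpectation]
    congr 1
    ext t
    simp
  simp only [rademacherComplexity, classicalAdvClass, functionClass]
  congr! 6 with σ t
  constructor
  · rintro ⟨_, ⟨_, ⟨A, hA, rfl⟩, rfl⟩, rfl⟩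
    exact ⟨A, hA, by simp only [h]⟩
  · rintro ⟨A, hA, rfl⟩
    exact ⟨_, ⟨_, ⟨A, hA, rfl⟩, rfl⟩, by simp only [h]⟩

theorem lpDist_self {d : ℕ} {p : ℝ≥0∞} (hp : 1 ≤ p) (x : Fin d → ℝ) : lpDist p x x = 0 := by
  have : Fact (1 ≤ p) := ⟨hp⟩
  simp [lpDist]

end Expectation

theorem theorem3 :
    ∃ J : ℝ≥0∞ → ℝ,
      (∃ C : ℝ, ∀ r : ℝ≥0∞, 1 ≤ r → |J r| ≤ C * √(1 + (1 / r).toReal)) ∧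
      ∀ (r p : ℝ≥0∞), 1 ≤ r → 1 ≤ p →
      ∀ (b ε : ℝ), 0 ≤ b → 0 ≤ ε →
      ∀ (d dH : ℕ) (X : Set (Fin d → ℝ)) (ρ : X → DensityMatrix dH),
        (∀ (m : ℕ), 0 < m → ∀ (x : Fin m → X) (y : Fin m → ℤˣ),
          rademacherComplexity (classicalAdvClass ρ r b p ε) (fun i => (x i, y i)) ≤
              rademacherComplexity (functionClass ρ r b) x
                + b * classicalS ρ r p ε * J r / √(m : ℝ) ∧
          rademacherComplexity (quantumAdvClass ρ r b p ε) (fun i => (x i, y i)) ≤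
              rademacherComplexity (functionClass ρ r b) x
                + b * quantumS ρ r p ε * J r / √(m : ℝ)) ∧
        quantumS ρ r p ε ≤
          ε * max (dH : ℝ) ((dH : ℝ) ^ (2 - (1 / r).toReal - (1 / p).toReal)) := by
  -- A constant `J` is admissible because `√(1 + 1/r) ≥ 1`.
  refine ⟨fun _ => 9 * √2, ⟨9 * √2, fun r _ => ?_⟩, fun r p hr hp b ε hb hε d n X ρ =>
    ⟨fun m hm x y => ?_, quantumS_le ρ hr hp hε⟩⟩
  · rw [abs_of_nonneg (by positivity)]
    refine le_mul_of_one_le_right (by positivity) (Real.one_le_sqrt.2 ?_)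
    have : 0 ≤ (1 / r).toReal := ENNReal.toReal_nonneg
    linarith
  have hq : 1 ≤ r.conjExponent := by rw [ENNReal.conjExponent]; exact le_self_add
  obtain ⟨c, hc⟩ := DensityMatrix.exists_schattenNorm_sub_le n hq
  rw [rademacherComplexity_functionClass, rademacherComplexity_classicalAdvClass,
    rademacherComplexity_quantumAdvClass]
  constructor
  · refine (rademacher_worstExpectation_le hm hr hb (fun i => ρ (x i))
      (fun i => ρ '' {x' | lpDist p (x i : Fin d → ℝ) (x' : Fin d → ℝ) ≤ ε})
      (fun i => ⟨x i, (lpDist_self hp _).trans_le hε, rfl⟩)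
      (D := sSup {t : ℝ | ∃ x x' : X, lpDist p (x : Fin d → ℝ) (x' : Fin d → ℝ) ≤ ε ∧
        t = schattenNorm r.conjExponent ((ρ x).mat - (ρ x').mat)}) ?_ y).trans
      (add_le_add_right (le_of_eq ?_) _)
    · rintro i _ ⟨x', hx', rfl⟩
      refine le_csSup ⟨c, ?_⟩ ⟨x i, x', hx', rfl⟩
      rintro _ ⟨_, _, _, rfl⟩
      exact hc _ _
    · rw [classicalS]; ring
  · refine (rademacher_worstExpectation_le hm hr hb (fun i => ρ (x i))
      (fun i => {ρ' | schattenNorm p ((ρ (x i)).mat - ρ'.mat) ≤ ε}) (fun i => ?_)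
      (D := sSup {t : ℝ | ∃ (x : X) (ρ' : DensityMatrix n),
        schattenNorm p ((ρ x).mat - ρ'.mat) ≤ ε ∧
        t = schattenNorm r.conjExponent ((ρ x).mat - ρ'.mat)}) ?_ y).trans
      (add_le_add_right (le_of_eq ?_) _)
    · rw [Set.mem_ofPred_eq, sub_self, schattenNorm_zero hp]
      exact hε
    · intro i ρ' hρ'
      refine le_csSup ⟨c, ?_⟩ ⟨x i, ρ', hρ', rfl⟩
      rintro _ ⟨_, _, _, rfl⟩
      exact hc _ _
    · rw [quantumS]; ring
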